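/- Let $X\neq\{0\}$ be a real Banach space (a complex Banach space is regarded as a real one), and let $C\subset X$ be a closed convex cone with $C\cap(-C)=\{0\}$ and interior $C_0$. Write $x\le y$ if $y-x\in C$ and $x\ll y$ if $y-x\in C_0$; put $[x,y]=\{z: x\le z\le y\}$ and $(x,y)=\{z: x\ll z\ll y\}$. For $x\in X$ and $y\in C_0$ let $M(x/y)=\inf\{t\in\mathbb R: x\le ty\}$ and $m(x/y)=\sup\{t\in\mathbb R: ty\le x\}$, and for $x,y\in C_0$ let $d_T(x,y)=\ln\max\{M(x/y),M(y/x)\}$ (Thompson's part metric). Let $\varphi:C_0\to X$ be Fréchet differentiable, with derivative bounded on every closed bounded subset of $X$ contained in $C_0$. For $x\in C_0$ let $t\mapsto M_t(x)\in C_0$, $0\le t<t_{C_0}(x)\le+\infty$, be the maximal solution in $C_0$ of $\dot x(t)=\varphi(x(t))$, $x(0)=x$. For an open set $U\subset C_0$ and $x\in U$ let $t_U(x)\le t_{C_0}(x)$ be the first time at which the trajectory leaves $U$, that is, the supremum of the real $b\in(0,t_{C_0}(x))$ such that $M_t(x)\in U$ for all $t\in[0,b)$. Assume that the flow is order-preserving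 on $C_0$: if $x_1,x_2\in C_0$ and $x_1\ge x_2$, then $M_t(x_1)\ge M_t(x_2)$ for all $0\le t<\min(t_{C_0}(x_1),t_{C_0}(x_2))$. **Theorem (Convergence rate).** Let $\bar x\in C_0$ satisfy $\varphi(\bar x)=0$, let $\mu>1$, and let $U=(\mu^{-1}\bar x,\mu\bar x)$. Then the infimum $$\alpha=\inf_{\mu^{-1}<\lambda<\mu,\ \lambda\ne1} m\big((-(\lambda\ln\lambda)^{-1}\varphi(\lambda\bar x))/\bar x\big)$$ is finite, and it is the best constant, i.e. the greatest real number $\alpha$, such that $$d_T(M_t(x),\bar x)\le e^{-\alpha t}d_T(x,\bar x)\quad\text{for all }x\in U\text{ and }0\le t<t_U(x).$$ Moreover, if this $\alpha$ is non-negative, then for every $x\in[\mu^{-1}\bar x,\mu\bar x]$ $$d_T(M_t(x),\bar x)\le e^{-\alpha t}d_T(x,\bar x)$$ for all $t\ge0$ at which $M_t(x)$ is defined; and if the cone $C$ is normal (there is a constant $K$ with $\|x\|\le K\|y\|$ whenever $0\le x\le y$), then $M_t(x)$ is defined for all $t\ge0$, so that the estimate holds for all $t\ge0$. -/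

import Mathlib

namespace Thompson

noncomputable section

variable {X : Type*} [NormedAddCommGroup X] [NormedSpace ℝ X]

/-- The order induced by the cone `C`: `x ≤ y` iff `y - x ∈ C`. -/
def Le (C : ProperCone ℝ X) (x y : X) : Prop := y - x ∈ C

/-- The strict relation `x ≪ y`: `y - x` is in the interior of `C`. -/
def Ll (C : ProperCone ℝ X) (x y : X) : Prop := y - x ∈ interior (C : Set X)

/-- The cone contains no line: `C ∩ (-C) = {0}`. -/
def IsPointed (C : ProperCone ℝ X) : Prop := ∀ x ∈ C, -x ∈ C → x = 0

/-- The cone is normal: `0 ≤ x ≤ y` implies `‖x‖ ≤ K ‖y‖`, for some constant `K`. -/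
def IsNormal (C : ProperCone ℝ X) : Prop :=
  ∃ K : ℝ, ∀ x y : X, Le C 0 x → Le C x y → ‖x‖ ≤ K * ‖y‖

/-- The closed order interval `[x, y]`. -/
def closedInterval (C : ProperCone ℝ X) (x y : X) : Set X := {z | Le C x z ∧ Le C z y}

/-- The open order interval `(x, y)`. -/
def openInterval (C : ProperCone ℝ X) (x y : X) : Set X := {z | Ll C x z ∧ Ll C z y}

/-- `M(x/y) = inf {t : x ≤ t y}`. -/
def upperRatio (C : ProperCone ℝ X) (x y : X) : ℝ := sInf {t : ℝ | Le C x (t • y)}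

/-- `m(x/y) = sup {t : t y ≤ x}`. -/
def lowerRatio (C : ProperCone ℝ X) (x y : X) : ℝ := sSup {t : ℝ | Le C (t • y) x}

/-- The Thompson part metric, for `x` and `y` in the interior of the cone. -/
def dT (C : ProperCone ℝ X) (x y : X) : ℝ :=
  Real.log (max (upperRatio C x y) (upperRatio C y x))

/-- `γ` solves `γ' = φ(γ)`, `γ(0) = x₀` on `[0, b)` with values in `D`. The derivative at `0` is
one-sided, those at `t > 0` are two-sided. When `φ` is continuous on `D`, such a `γ` is
continuously differentiable on `[0, b)`. -/
structure IsSolution (φ : X → X) (D : Set X) (x₀ : X) (b : ℝ) (γ : ℝ → X) : Prop where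
  initial : γ 0 = x₀
  mem : ∀ t : ℝ, 0 ≤ t → t < b → γ t ∈ D
  deriv : ∀ t : ℝ, 0 ≤ t → t < b → HasDerivWithinAt γ (φ (γ t)) (Set.Ici 0) t

/-- The end of the interval `[0, a)` on which the maximal solution issued from `x₀` is defined. -/
def existenceTime (φ : X → X) (D : Set X) (x₀ : X) : EReal :=
  sSup {a : EReal | ∃ b : ℝ, a = (b : EReal) ∧ 0 < b ∧ ∃ γ : ℝ → X, IsSolution φ D x₀ b γ}

open Classical in
/-- The flow `M_t(x₀)`: the value at time `t` of the solution issued from `x₀`. It is meaningful for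
`0 ≤ t < existenceTime φ D x₀`, and it is `0` by convention when no solution reaches time `t`. -/
def flow (φ : X → X) (D : Set X) (t : ℝ) (x₀ : X) : X :=
  if h : ∃ y : X, ∃ b : ℝ, ∃ γ : ℝ → X, IsSolution φ D x₀ b γ ∧ t < b ∧ γ t = y then h.choose else 0

/-- The first time `t_U(x₀)` at which the trajectory issued from `x₀` leaves `U`:
the supremum of the `b ∈ (0, a)`, `a` being the existence time, such that the trajectory stays
in `U` on `[0, b)`. -/
def exitTime (φ : X → X) (D U : Set X) (x₀ : X) : EReal :=
  sSup {a : EReal | ∃ b : ℝ, a = (b : EReal) ∧ 0 < b ∧ a < existenceTime φ D x₀ ∧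
    ∀ t : ℝ, 0 ≤ t → t < b → flow φ D t x₀ ∈ U}

/-- The flow of `φ` on the domain `D` is order-preserving on `U`. -/
def OrderPreservingOn (C : ProperCone ℝ X) (φ : X → X) (D U : Set X) : Prop :=
  ∀ x₁ ∈ U, ∀ x₂ ∈ U, Le C x₂ x₁ → ∀ t : ℝ, 0 ≤ t →
    (t : EReal) < min (exitTime φ D U x₁) (exitTime φ D U x₂) →
    Le C (flow φ D t x₂) (flow φ D t x₁)

/-- `φ` is Fréchet differentiable on the open set `D`, with a derivative that is bounded on each
closed bounded set contained in `D`. -/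
def IsAdmissible (φ : X → X) (D : Set X) : Prop :=
  (∀ x ∈ D, DifferentiableAt ℝ φ x) ∧
    ∀ K : Set X, K ⊆ D → IsClosed K → Bornology.IsBounded K →
      ∃ L : ℝ, ∀ x ∈ K, ‖fderiv ℝ φ x‖ ≤ L

end

end Thompson

namespace Thompson

open Set Filter Topology Metric
open scoped NNReal

/-! ### Local existence, uniqueness and gluing of solutions. -/

section Solutions

variable {X : Type*} [NormedAddCommGroup X] [NormedSpace ℝ X]

/-! On the ray through the rest point `e`, the curve `l(s) • e` with `l(s) = exp (exp (-α s) * d)`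
solves `l' = -α l log l`, and its `log` is contracted exactly at rate `α`. The lower ratios say how
`φ (l • e)` compares in the cone order with `-α (l log l) • e`. If `α` bounds them below, this curve
is a supersolution for `l > 1`, and a subsolution for `l < 1` (replace `d` by `-d`). A trajectory
starting at distance `d` lies between the two curves at time `0`; order preservation keeps it there
(`le_of_subsolution`), and by `dT_le_iff` this is the estimate (`RadialBound.dT_le`).

Conversely, a trajectory starting at `l • e` touches one of these curves at time `0`. A contraction
rate keeps it on one side, so comparing the velocities at time `0` bounds the lower ratio
(`le_lowerRatio_of_dT_le`).

Finiteness of the infimum comes from `φ e = 0` and a Lipschitz bound on the segment of the ray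
(`bddBelow_lowerRatio`). For `α ≥ 0` the closed interval is invariant; in a normal cone it is
bounded, which gives a uniform existence time and hence global solutions. -/

theorem IsAdmissible.exists_lipschitzOnWith {φ : X → X} {D S : Set X} (hφ : IsAdmissible φ D)
    (hSD : S ⊆ D) (hS : IsClosed S) (hSb : Bornology.IsBounded S) (hSc : Convex ℝ S) :
    ∃ K : ℝ≥0, LipschitzOnWith K φ S := by
  obtain ⟨L, hL⟩ := hφ.2 S hSD hS hSb
  refine ⟨L.toNNReal, hSc.lipschitzOnWith_of_nnnorm_fderiv_le (fun x hx => hφ.1 x (hSD hx)) ?_⟩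
  intro x hx
  rw [← NNReal.coe_le_coe, coe_nnnorm]
  exact (hL x hx).trans (Real.le_coe_toNNReal L)

/-- `φ` is Lipschitz on some closed ball around each point of `D`, contained in `D`. -/
def LocallyLipschitzIn (φ : X → X) (D : Set X) : Prop :=
  ∀ x ∈ D, ∃ K : ℝ≥0, ∃ r : ℝ, 0 < r ∧ closedBall x r ⊆ D ∧ LipschitzOnWith K φ (closedBall x r)

theorem IsAdmissible.locallyLipschitzIn {φ : X → X} {D : Set X} (hφ : IsAdmissible φ D)
    (hD : IsOpen D) : LocallyLipschitzIn φ D := by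
  intro x hx
  obtain ⟨r, hr, hrD⟩ := nhds_basis_closedBall.mem_iff.1 (hD.mem_nhds hx)
  obtain ⟨K, hK⟩ := hφ.exists_lipschitzOnWith hrD isClosed_closedBall isBounded_closedBall
    (convex_closedBall x r)
  exact ⟨K, r, hr, hrD, hK⟩

theorem IsSolution.continuousWithinAt {φ : X → X} {D : Set X} {x : X} {b t : ℝ} {γ : ℝ → X}
    (h : IsSolution φ D x b γ) (h0 : 0 ≤ t) (hb : t < b) : ContinuousWithinAt γ (Ici 0) t :=
  (h.deriv t h0 hb).continuousWithinAt

theorem IsSolution.continuousOn {φ : X → X} {D : Set X} {x : X} {b s t : ℝ} {γ : ℝ → X}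
    (h : IsSolution φ D x b γ) (h0 : 0 ≤ s) (hb : t < b) : ContinuousOn γ (Icc s t) :=
  fun _ hr => (h.continuousWithinAt (h0.trans hr.1) (hr.2.trans_lt hb)).mono
    (Icc_subset_Ici_self.trans (Ici_subset_Ici.2 h0))

theorem IsSolution.mono {φ : X → X} {D : Set X} {x : X} {b c : ℝ} {γ : ℝ → X}
    (h : IsSolution φ D x b γ) (hc : c ≤ b) : IsSolution φ D x c γ :=
  ⟨h.initial, fun t h0 ht => h.mem t h0 (ht.trans_le hc),
    fun t h0 ht => h.deriv t h0 (ht.trans_le hc)⟩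

theorem hasDerivWithinAt_comp_add_right {γ : ℝ → X} {v : X} {s s' : Set ℝ} {c t : ℝ}
    (h : HasDerivWithinAt γ v s' (t + c)) (hs : MapsTo (fun r => r + c) s s') :
    HasDerivWithinAt (fun r => γ (r + c)) v s t := by
  have := HasDerivWithinAt.scomp t h (((hasDerivAt_id t).add_const c).hasDerivWithinAt (s := s)) hs
  simpa [Function.comp_def] using this

/-- At the junction the left and right derivatives agree, both being `φ (γ c)`. -/
theorem IsSolution.glue {φ : X → X} {D : Set X} {x : X} {b c τ : ℝ} {γ η : ℝ → X}
    (h : IsSolution φ D x b γ) (hc : 0 ≤ c) (hcb : c < b) (hη : IsSolution φ D (γ c) τ η) :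
    ∃ ζ : ℝ → X, IsSolution φ D x (c + τ) ζ := by
  set ζ : ℝ → X := fun t => if t ≤ c then γ t else η (t - c) with hζ
  have e1 : ∀ t, t ≤ c → ζ t = γ t := fun t ht => by simp [hζ, ht]
  have e2 : ∀ t, c ≤ t → ζ t = η (t - c) := by
    intro t ht
    rcases ht.eq_or_lt with rfl | ht
    · simp [hζ, hη.initial]
    · simp [hζ, not_le.2 ht]
  have d2 : ∀ t, c ≤ t → t < c + τ →
      HasDerivWithinAt ζ (φ (ζ t)) (Ici c) t := by
    intro t h0 ht
    rw [e2 t h0]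
    have := hasDerivWithinAt_comp_add_right (s := Ici c) (c := -c) (t := t)
      (hη.deriv (t + -c) (by linarith) (by linarith)) (fun r hr => by
        have : c ≤ r := hr
        show 0 ≤ r + -c
        linarith)
    exact this.congr (fun r hr => e2 r hr) (e2 t h0)
  refine ⟨ζ, (e1 0 hc).trans h.initial, fun t h0 ht => ?_, fun t h0 ht => ?_⟩
  · rcases le_total t c with htc | htc
    · rw [e1 t htc]; exact h.mem t h0 (htc.trans_lt hcb)
    · rw [e2 t htc]; exact hη.mem _ (by linarith) (by linarith)
  · rcases lt_trichotomy t c with htc | htc | htc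
    · rw [e1 t htc.le]
      refine (h.deriv t h0 (htc.trans hcb)).congr_of_eventuallyEq ?_ (e1 t htc.le)
      filter_upwards [mem_nhdsWithin_of_mem_nhds (Iio_mem_nhds htc)] with r hr
      exact e1 r (le_of_lt hr)
    · subst htc
      have l : HasDerivWithinAt ζ (φ (ζ t)) (Icc 0 t) t := by
        rw [e1 t le_rfl]
        exact ((h.deriv t h0 hcb).mono Icc_subset_Ici_self).congr
          (fun r hr => e1 r hr.2) (e1 t le_rfl)
      have := l.union (d2 t le_rfl ht)
      rwa [Icc_union_Ici_eq_Ici hc] at this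
    · refine (d2 t htc.le ht).mono_of_mem_nhdsWithin ?_
      exact mem_nhdsWithin_of_mem_nhds (Ici_mem_nhds htc)

/-- The set of agreement is closed, and it extends to the right of each of its points by uniqueness
in a ball where `φ` is Lipschitz. -/
theorem IsSolution.eq_of_isSolution {φ : X → X} {D : Set X} {x : X} {b c t : ℝ} {γ η : ℝ → X}
    (hL : LocallyLipschitzIn φ D) (h : IsSolution φ D x b γ) (h' : IsSolution φ D x c η)
    (h0 : 0 ≤ t) (hb : t < b) (hc : t < c) : γ t = η t := by
  have key : Icc 0 t ⊆ {s | γ s = η s} := by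
    refine IsClosed.Icc_subset_of_forall_exists_gt ?_ (h.initial.trans h'.initial.symm) ?_
    · have := ((h.continuousOn le_rfl hb).sub
        (h'.continuousOn le_rfl hc)).preimage_isClosed_of_isClosed isClosed_Icc
        (isClosed_singleton (x := (0 : X)))
      convert this using 1
      ext s
      simp [sub_eq_zero, and_comm]
    · rintro s ⟨hs, hs0, hst⟩ y hy
      obtain ⟨K, r, hr, hrD, hK⟩ := hL (γ s) (h.mem s hs0 (hst.trans hb))
      have c1 : ∀ᶠ u in 𝓝[≥] s, γ u ∈ closedBall (γ s) r :=
        ((h.continuousWithinAt hs0 (hst.trans hb)).mono (Ici_subset_Ici.2 hs0)).eventually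
          (closedBall_mem_nhds _ hr)
      have c2 : ∀ᶠ u in 𝓝[≥] s, η u ∈ closedBall (γ s) r := by
        have hs' : γ s = η s := hs
        rw [hs']
        exact ((h'.continuousWithinAt hs0 (hst.trans hc)).mono (Ici_subset_Ici.2 hs0)).eventually
          (closedBall_mem_nhds _ hr)
      obtain ⟨u, hu, hsub⟩ := mem_nhdsGE_iff_exists_Icc_subset.1 (c1.and c2)
      set w := min u (min y t) with hw
      have hsw : s < w := lt_min hu (lt_min hy hst)
      have hwt : w ≤ t := (min_le_right _ _).trans (min_le_right _ _)
      have hwu : w ≤ u := min_le_left _ _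
      have := ODE_solution_unique_of_mem_Icc_right (v := fun _ => φ)
        (s := fun _ => closedBall (γ s) r) (K := K) (f := γ) (g := η) (a := s) (b := w)
        (fun _ _ => hK) (h.continuousOn hs0 (hwt.trans_lt hb))
        (fun q hq => (h.deriv q (hs0.trans hq.1) (hq.2.trans (hwt.trans_lt hb))).mono
          (Ici_subset_Ici.2 (hs0.trans hq.1)))
        (fun q hq => (hsub ⟨hq.1, hq.2.le.trans hwu⟩).1)
        (h'.continuousOn hs0 (hwt.trans_lt hc))
        (fun q hq => (h'.deriv q (hs0.trans hq.1) (hq.2.trans (hwt.trans_lt hc))).mono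
          (Ici_subset_Ici.2 (hs0.trans hq.1)))
        (fun q hq => (hsub ⟨hq.1, hq.2.le.trans hwu⟩).2) hs
      exact ⟨w, this ⟨hsw.le, le_rfl⟩, hsw, (min_le_right _ _).trans (min_le_left _ _)⟩
  exact key ⟨h0, le_rfl⟩

theorem IsSolution.flow_eq {φ : X → X} {D : Set X} {x : X} {b t : ℝ} {γ : ℝ → X}
    (hL : LocallyLipschitzIn φ D) (h : IsSolution φ D x b γ) (h0 : 0 ≤ t) (hb : t < b) :
    flow φ D t x = γ t := by
  have hex : ∃ y : X, ∃ b : ℝ, ∃ γ : ℝ → X, IsSolution φ D x b γ ∧ t < b ∧ γ t = y :=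
    ⟨γ t, b, γ, h, hb, rfl⟩
  rw [flow, dif_pos hex]
  obtain ⟨c, η, hη, hc, he⟩ := hex.choose_spec
  rw [← he]
  exact hη.eq_of_isSolution hL h h0 hc hb

theorem IsSolution.lt_existenceTime {φ : X → X} {D : Set X} {x : X} {b t : ℝ} {γ : ℝ → X}
    (h : IsSolution φ D x b γ) (h0 : 0 ≤ t) (hb : t < b) :
    (t : EReal) < existenceTime φ D x :=
  (EReal.coe_lt_coe_iff.2 hb).trans_le (le_sSup ⟨b, rfl, h0.trans_lt hb, γ, h⟩)

theorem exists_isSolution_of_lt_existenceTime {φ : X → X} {D : Set X} {x : X} {t : ℝ}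
    (h : (t : EReal) < existenceTime φ D x) :
    ∃ b : ℝ, t < b ∧ ∃ γ : ℝ → X, IsSolution φ D x b γ := by
  obtain ⟨_, ⟨b, rfl, -, γ, hγ⟩, hb⟩ := lt_sSup_iff.1 h
  exact ⟨b, EReal.coe_lt_coe_iff.1 hb, γ, hγ⟩

theorem lt_exitTime {φ : X → X} {D U : Set X} {x : X} {b t : ℝ} {γ : ℝ → X}
    (hL : LocallyLipschitzIn φ D) (h : IsSolution φ D x b γ) (h0 : 0 ≤ t) (hb : t < b)
    (hU : ∀ s, 0 ≤ s → s < b → γ s ∈ U) : (t : EReal) < exitTime φ D U x := by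
  -- The definition of `exitTime` asks for a time strictly below the existence time, so `b` itself
  -- may not qualify.
  have h1 : t < (t + b) / 2 := by linarith
  have h2 : (t + b) / 2 < b := by linarith
  refine (EReal.coe_lt_coe_iff.2 h1).trans_le (le_sSup ⟨_, rfl, by linarith,
    h.lt_existenceTime (by linarith) h2, fun s hs0 hs => ?_⟩)
  rw [h.flow_eq hL hs0 (hs.trans h2)]
  exact hU s hs0 (hs.trans h2)

theorem exists_isSolution_of_lt_exitTime {φ : X → X} {D U : Set X} {x : X} {t : ℝ}
    (hL : LocallyLipschitzIn φ D) (h : (t : EReal) < exitTime φ D U x) :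
    ∃ b : ℝ, t < b ∧ ∃ γ : ℝ → X, IsSolution φ D x b γ ∧ ∀ s, 0 ≤ s → s < b → γ s ∈ U := by
  obtain ⟨_, ⟨b, rfl, -, hb', hbU⟩, hb⟩ := lt_sSup_iff.1 h
  obtain ⟨c, hc, γ, hγ⟩ := exists_isSolution_of_lt_existenceTime hb'
  refine ⟨b, EReal.coe_lt_coe_iff.1 hb, γ, hγ.mono hc.le, fun s h0 hs => ?_⟩
  rw [← hγ.flow_eq hL h0 (hs.trans hc)]
  exact hbU s h0 hs

/-- Picard–Lindelöf with an explicit time, which later makes the existence time uniform. The fixed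
point of the Picard map is used directly because it is known to stay in the ball, hence in `D`. -/
theorem exists_isSolution_of_lipschitzOnWith [CompleteSpace X] {φ : X → X} {D : Set X} {x : X}
    {K : ℝ≥0} {r B τ : ℝ} (hD : closedBall x r ⊆ D) (hK : LipschitzOnWith K φ (closedBall x r))
    (hB : ∀ y ∈ closedBall x r, ‖φ y‖ ≤ B) (hr : 0 ≤ r) (hτ : 0 < τ) (hBτ : B * τ ≤ r) :
    ∃ γ : ℝ → X, IsSolution φ D x τ γ := by
  have hB0 : 0 ≤ B := (norm_nonneg _).trans (hB x (mem_closedBall_self hr))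
  lift r to ℝ≥0 using hr
  lift B to ℝ≥0 using hB0
  have hP : IsPicardLindelof (fun _ => φ) (tmin := 0) (tmax := τ) ⟨0, le_rfl, hτ.le⟩ x r 0 B K :=
    .of_time_independent hB hK (by simpa [hτ.le] using hBτ)
  have hx : x ∈ closedBall x ((0 : ℝ≥0) : ℝ) := by simp
  obtain ⟨α, hα⟩ := ODE.FunSpace.exists_isFixedPt_next hP hx
  have hmem : ∀ t, α.compProj t ∈ closedBall x (r : ℝ) :=
    fun t => α.compProj_mem_closedBall hP.mul_max_le
  refine ⟨α.compProj, ?_, fun t _ _ => hD (hmem t), fun t h0 ht => ?_⟩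
  · have := ODE.FunSpace.compProj_val (α := α) (t := ⟨0, le_rfl, hτ.le⟩)
    rw [← hα, ODE.FunSpace.next_apply₀] at this
    rw [← hα]
    exact this
  · have hd : HasDerivWithinAt α.compProj (φ (α.compProj t)) (Icc 0 τ) t := by
      refine (ODE.hasDerivWithinAt_picard_Icc (⟨0, le_rfl, hτ.le⟩ : Icc (0 : ℝ) τ).2
        hP.continuousOn_uncurry α.continuous_compProj.continuousOn (fun _ _ => hmem _) x
        ⟨h0, ht.le⟩).congr_of_mem ?_ ⟨h0, ht.le⟩
      intro t' ht'
      nth_rw 1 [← hα]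
      rw [ODE.FunSpace.compProj_of_mem ht', ODE.FunSpace.next_apply]
    refine hd.mono_of_mem_nhdsWithin ?_
    rw [← Ici_inter_Iic]
    exact inter_mem self_mem_nhdsWithin (mem_nhdsWithin_of_mem_nhds (Iic_mem_nhds ht))

theorem LocallyLipschitzIn.exists_isSolution [CompleteSpace X] {φ : X → X} {D : Set X} {x : X}
    (hL : LocallyLipschitzIn φ D) (hx : x ∈ D) :
    ∃ b : ℝ, 0 < b ∧ ∃ γ : ℝ → X, IsSolution φ D x b γ := by
  obtain ⟨K, r, hr, hrD, hK⟩ := hL x hx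
  have hB : ∀ y ∈ closedBall x r, ‖φ y‖ ≤ ‖φ x‖ + K * r := by
    intro y hy
    have h1 := hK.norm_sub_le hy (mem_closedBall_self hr.le)
    have h2 : ‖y - x‖ ≤ r := by rwa [← dist_eq_norm]
    have h3 : ‖φ y‖ ≤ ‖φ y - φ x‖ + ‖φ x‖ := norm_le_norm_sub_add _ _
    have h4 : K * ‖y - x‖ ≤ K * r := by gcongr
    linarith
  have hpos : 0 < ‖φ x‖ + K * r + 1 := by positivity
  refine ⟨r / (‖φ x‖ + K * r + 1), by positivity,
    exists_isSolution_of_lipschitzOnWith (B := ‖φ x‖ + K * r + 1) hrD hK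
      (fun y hy => (hB y hy).trans (by linarith)) hr.le (by positivity) ?_⟩
  rw [mul_div_cancel₀ _ hpos.ne']

end Solutions

/-! ### Interior of the cone and one-sided derivatives. -/

section Cone

variable {X : Type*} [NormedAddCommGroup X] [NormedSpace ℝ X]

theorem cone_add_mem (C : ProperCone ℝ X) {x y : X} (hx : x ∈ C) (hy : y ∈ C) : x + y ∈ C :=
  C.toSubmodule.add_mem hx hy

theorem add_mem_interior (C : ProperCone ℝ X) {x y : X} (hx : x ∈ interior (C : Set X))
    (hy : y ∈ C) : x + y ∈ interior (C : Set X) := by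
  have h : (fun z => z - y) ⁻¹' interior (C : Set X) ⊆ (C : Set X) := by
    intro z hz
    have := cone_add_mem C (interior_subset hz) hy
    simpa using this
  refine interior_maximal h (isOpen_interior.preimage (by fun_prop)) ?_
  simpa using hx

theorem smul_mem_interior (C : ProperCone ℝ X) {x : X} {r : ℝ} (hr : 0 < r)
    (hx : x ∈ interior (C : Set X)) : r • x ∈ interior (C : Set X) := by
  have h : (fun z => r⁻¹ • z) ⁻¹' interior (C : Set X) ⊆ (C : Set X) := by
    intro z hz
    have := C.smul_mem (interior_subset hz) hr.le
    simpa [smul_smul, hr.ne'] using this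
  refine interior_maximal h (isOpen_interior.preimage (by fun_prop)) ?_
  simpa [smul_smul, hr.ne'] using hx

theorem exists_add_mem_interior (C : ProperCone ℝ X) {x : X} (hx : x ∈ interior (C : Set X)) :
    ∃ δ : ℝ, 0 < δ ∧ ∀ v : X, ‖v‖ ≤ δ → x + v ∈ interior (C : Set X) := by
  obtain ⟨δ, hδ, h⟩ := nhds_basis_closedBall.mem_iff.1 (isOpen_interior.mem_nhds hx)
  exact ⟨δ, hδ, fun v hv => h (by simpa using hv)⟩

/-- Converts norm bounds into order bounds against an interior point. -/
theorem smul_add_mem_interior (C : ProperCone ℝ X) {x v : X} {δ L : ℝ}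
    (hδ : ∀ v : X, ‖v‖ ≤ δ → x + v ∈ interior (C : Set X)) (hL : 0 < L) (hv : ‖v‖ ≤ L * δ) :
    L • x + v ∈ interior (C : Set X) := by
  have h1 : ‖L⁻¹ • v‖ ≤ δ := by
    rw [norm_smul, norm_inv, Real.norm_of_nonneg hL.le, inv_mul_le_iff₀ hL]
    exact hv
  have := smul_mem_interior C hL (hδ _ h1)
  simpa [smul_smul, hL.ne'] using this

theorem eventually_mem_of_hasDerivWithinAt (C : ProperCone ℝ X) {F : ℝ → X} {w : X} {s : ℝ}
    (hF : HasDerivWithinAt F w (Ici s) s) (hw : w ∈ interior (C : Set X)) :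
    ∀ᶠ t in 𝓝[>] s, F t - F s ∈ C := by
  have h := (hasDerivWithinAt_iff_tendsto_slope.1 hF)
  rw [Ici_sdiff_left] at h
  filter_upwards [h.eventually (isOpen_interior.mem_nhds hw), self_mem_nhdsWithin] with t ht hst
  have hst' : 0 < t - s := sub_pos.2 hst
  have := C.smul_mem (interior_subset ht) hst'.le
  rwa [slope_def_module, smul_smul, mul_inv_cancel₀ hst'.ne', one_smul] at this

theorem mem_of_hasDerivWithinAt (C : ProperCone ℝ X) {F : ℝ → X} {w : X} {s : ℝ}
    (hF : HasDerivWithinAt F w (Ici s) s) (h : ∀ᶠ t in 𝓝[>] s, F t - F s ∈ C) : w ∈ C := by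
  have h' := (hasDerivWithinAt_iff_tendsto_slope.1 hF)
  rw [Ici_sdiff_left] at h'
  refine C.isClosed.mem_of_tendsto h' ?_
  filter_upwards [h, self_mem_nhdsWithin] with t ht hst
  have hst' : 0 < t - s := sub_pos.2 hst
  have := C.smul_mem ht (inv_pos.2 hst').le
  rwa [← slope_def_module] at this

end Cone

/-! ### Comparison of sub- and supersolutions under an order-preserving flow. -/

section Comparison

variable {X : Type*} [NormedAddCommGroup X] [NormedSpace ℝ X]

theorem OrderPreservingOn.le_of_isSolution {C : ProperCone ℝ X} {φ : X → X} {D : Set X}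
    (hmono : OrderPreservingOn C φ D D) (hL : LocallyLipschitzIn φ D) {x y : X} {b : ℝ}
    {γ η : ℝ → X} (hγ : IsSolution φ D x b γ) (hη : IsSolution φ D y b η) (hxy : Le C x y)
    {t : ℝ} (h0 : 0 ≤ t) (ht : t < b) : Le C (γ t) (η t) := by
  have hb := h0.trans_lt ht
  have hx : x ∈ D := hγ.initial ▸ hγ.mem 0 le_rfl hb
  have hy : y ∈ D := hη.initial ▸ hη.mem 0 le_rfl hb
  rw [← hγ.flow_eq hL h0 ht, ← hη.flow_eq hL h0 ht]
  exact hmono y hy x hx hxy t h0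
    (lt_min (lt_exitTime hL hη h0 ht hη.mem) (lt_exitTime hL hγ h0 ht hγ.mem))

variable [CompleteSpace X]

/-- Strict sub- and supersolutions of an order-preserving flow stay ordered. -/
theorem le_of_strict_subsolution {C : ProperCone ℝ X} {φ : X → X} {D : Set X}
    (hmono : OrderPreservingOn C φ D D) (hL : LocallyLipschitzIn φ D) {a b a' b' : ℝ → X}
    {s T : ℝ} (hac : ContinuousOn a (Icc s T)) (hbc : ContinuousOn b (Icc s T))
    (haD : ∀ t ∈ Ico s T, a t ∈ D) (hbD : ∀ t ∈ Ico s T, b t ∈ D)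
    (ha : ∀ t ∈ Ico s T, HasDerivWithinAt a (a' t) (Ici t) t)
    (hb : ∀ t ∈ Ico s T, HasDerivWithinAt b (b' t) (Ici t) t)
    (hab : ∀ t ∈ Ico s T, (b' t - φ (b t)) - (a' t - φ (a t)) ∈ interior (C : Set X))
    (h0 : Le C (a s) (b s)) : ∀ t ∈ Icc s T, Le C (a t) (b t) := by
  refine IsClosed.Icc_subset_of_forall_exists_gt (s := {t | Le C (a t) (b t)}) ?_ h0 ?_
  · rw [inter_comm]
    exact (hbc.sub hac).preimage_isClosed_of_isClosed isClosed_Icc C.isClosed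
  · rintro t ⟨ht, htI⟩ y hy
    -- Restart the flow at `a t` and `b t`. These solutions stay ordered, and the right derivative
    -- at `t` of `(b - η) - (a - γ)` is interior to the cone, so this difference stays in `C` just
    -- after `t`.
    obtain ⟨c, hc, γ, hγ⟩ := hL.exists_isSolution (haD t htI)
    obtain ⟨d, hd, η, hη⟩ := hL.exists_isSolution (hbD t htI)
    set e := min c d with he
    have hep : 0 < e := lt_min hc hd
    replace hγ := hγ.mono (min_le_left c d)
    replace hη := hη.mono (min_le_right c d)
    have dγ : HasDerivWithinAt (fun r => γ (r + -t)) (φ (a t)) (Ici t) t := by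
      have := hγ.deriv 0 le_rfl hep
      rw [hγ.initial] at this
      refine hasDerivWithinAt_comp_add_right (s' := Ici 0) (by simpa using this) ?_
      intro r (hr : t ≤ r)
      show 0 ≤ r + -t
      linarith
    have dη : HasDerivWithinAt (fun r => η (r + -t)) (φ (b t)) (Ici t) t := by
      have := hη.deriv 0 le_rfl hep
      rw [hη.initial] at this
      refine hasDerivWithinAt_comp_add_right (s' := Ici 0) (by simpa using this) ?_
      intro r (hr : t ≤ r)
      show 0 ≤ r + -t
      linarith
    have hF := eventually_mem_of_hasDerivWithinAt C
      (((hb t htI).sub dη).sub ((ha t htI).sub dγ)) (hab t htI)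
    have hlt : ∀ᶠ r in 𝓝[>] t, r < min y (min T (t + e)) :=
      mem_nhdsWithin_of_mem_nhds (Iio_mem_nhds (lt_min hy (lt_min htI.2 (by linarith))))
    obtain ⟨r, hr, hr2, hr3 : t < r⟩ := (hF.and (hlt.and self_mem_nhdsWithin)).exists
    obtain ⟨hry, hrT, hre⟩ := by simpa only [lt_min_iff] using hr2
    refine ⟨r, ?_, hr3, hry.le⟩
    have h1 : Le C (γ (r + -t)) (η (r + -t)) :=
      hmono.le_of_isSolution hL hγ hη ht (by linarith) (by linarith)
    have h2 := cone_add_mem C hr h1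
    show b r - a r ∈ C
    convert h2 using 1
    simp only [Pi.sub_apply, add_neg_cancel, hγ.initial, hη.initial]
    abel

/-- Sub- and supersolutions of an order-preserving flow stay ordered. -/
theorem le_of_subsolution {C : ProperCone ℝ X} {φ : X → X}
    (hmono : OrderPreservingOn C φ (interior (C : Set X)) (interior (C : Set X)))
    (hL : LocallyLipschitzIn φ (interior (C : Set X))) {a b a' b' : ℝ → X}
    {s T : ℝ} (hac : ContinuousOn a (Icc s T)) (hbc : ContinuousOn b (Icc s T))
    (haD : ∀ t ∈ Ico s T, a t ∈ interior (C : Set X))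
    (hbD : ∀ t ∈ Ico s T, b t ∈ interior (C : Set X))
    (ha : ∀ t ∈ Ico s T, HasDerivWithinAt a (a' t) (Ici t) t)
    (hb : ∀ t ∈ Ico s T, HasDerivWithinAt b (b' t) (Ici t) t)
    (hab : ∀ t ∈ Ico s T, (b' t - φ (b t)) - (a' t - φ (a t)) ∈ C)
    (h0 : Le C (a s) (b s)) : ∀ t ∈ Icc s T, Le C (a t) (b t) := by
  refine IsClosed.Icc_subset_of_forall_exists_gt (s := {t | Le C (a t) (b t)}) ?_ h0 ?_
  · rw [inter_comm]
    exact (hbc.sub hac).preimage_isClosed_of_isClosed isClosed_Icc C.isClosed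
  · rintro t ⟨ht, htI⟩ y hy
    set e := b t with he
    have heD : e ∈ interior (C : Set X) := hbD t htI
    obtain ⟨K, r, hr, hrD, hK⟩ := hL e heD
    obtain ⟨δ, hδ, hδe⟩ := exists_add_mem_interior C heD
    -- The perturbation `ε (1 + Λ (q - t)) • e` makes `b` strict: its growth `ε Λ • e` must dominate
    -- the change it causes in `φ`, at most `2 ε K ‖e‖`. A window of length `Λ⁻¹` keeps its
    -- coefficient below `2 ε`.
    set Λ : ℝ := (2 * K * ‖e‖ + 1) / δ with hΛ
    have hΛp : 0 < Λ := by positivity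
    have hcont : ∀ᶠ u in 𝓝[≥] t, b u ∈ closedBall e (r / 2) :=
      (hb t htI).continuousWithinAt.eventually (closedBall_mem_nhds _ (half_pos hr))
    obtain ⟨u, hu : t < u, hsub⟩ := mem_nhdsGE_iff_exists_Icc_subset.1 hcont
    set w := min (min u (t + Λ⁻¹)) (min y T) with hw
    have htw : t < w := lt_min (lt_min hu (by simpa using hΛp)) (lt_min hy htI.2)
    have hwu : w ≤ u := (min_le_left _ _).trans (min_le_left _ _)
    have hwΛ : w ≤ t + Λ⁻¹ := (min_le_left _ _).trans (min_le_right _ _)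
    have hwy : w ≤ y := (min_le_right _ _).trans (min_le_left _ _)
    have hwT : w ≤ T := (min_le_right _ _).trans (min_le_right _ _)
    have hIco : ∀ q ∈ Ico t w, q ∈ Ico s T :=
      fun q hq => ⟨htI.1.trans hq.1, hq.2.trans_le hwT⟩
    have hIcc : Icc t w ⊆ Icc s T := Icc_subset_Icc htI.1 hwT
    have main : ∀ᶠ ε : ℝ in 𝓝[>] 0, b w + (ε * (1 + Λ * (w - t))) • e - a w ∈ C := by
      have hsmall : ∀ᶠ ε : ℝ in 𝓝[>] 0, ε * (2 * ‖e‖) ≤ r / 2 := by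
        have : Tendsto (fun ε : ℝ => ε * (2 * ‖e‖)) (𝓝[>] 0) (𝓝 (0 * (2 * ‖e‖))) :=
          ((continuous_id.mul continuous_const).tendsto 0).mono_left nhdsWithin_le_nhds
        rw [zero_mul] at this
        filter_upwards [this.eventually (Iio_mem_nhds (half_pos hr))] with ε hε using le_of_lt hε
      filter_upwards [hsmall, self_mem_nhdsWithin] with ε hε hε0
      replace hε0 : 0 < ε := hε0
      have hθ : ∀ q ∈ Ico t w, 0 ≤ ε * (1 + Λ * (q - t)) ∧ ε * (1 + Λ * (q - t)) ≤ 2 * ε := by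
        intro q hq
        have h1 : 0 ≤ q - t := sub_nonneg.2 hq.1
        have h2 : q - t ≤ Λ⁻¹ := by linarith [hq.2]
        have h3 : Λ * (q - t) ≤ 1 := by
          calc Λ * (q - t) ≤ Λ * Λ⁻¹ := by gcongr
            _ = 1 := mul_inv_cancel₀ hΛp.ne'
        exact ⟨by positivity, by nlinarith⟩
      refine le_of_strict_subsolution hmono hL (a := a) (a' := a')
        (b := fun q => b q + (ε * (1 + Λ * (q - t))) • e) (b' := fun q => b' q + (ε * Λ) • e)
        (s := t) (T := w) (hac.mono hIcc) ((hbc.mono hIcc).add (by fun_prop))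
        (fun q hq => haD q (hIco q hq)) (fun q hq => ?_) (fun q hq => ha q (hIco q hq))
        (fun q hq => ?_) (fun q hq => ?_) ?_ w ⟨htw.le, le_rfl⟩
      · exact add_mem_interior C (hbD q (hIco q hq))
          (C.smul_mem (interior_subset heD) (hθ q hq).1)
      · refine (hb q (hIco q hq)).add ?_
        have : HasDerivAt (fun q => ε * (1 + Λ * (q - t))) (ε * Λ) q := by
          simpa using ((((hasDerivAt_id q).sub_const t).const_mul Λ).const_add 1).const_mul ε
        exact (this.smul_const e).hasDerivWithinAt
      · set θ := ε * (1 + Λ * (q - t)) with hθq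
        obtain ⟨hθ0, hθ1⟩ := hθ q hq
        have hn : ‖θ • e‖ ≤ 2 * ε * ‖e‖ := by
          rw [norm_smul, Real.norm_of_nonneg hθ0]; gcongr
        have hbq : b q ∈ closedBall e (r / 2) := hsub ⟨hq.1, hq.2.le.trans hwu⟩
        rw [mem_closedBall, dist_eq_norm] at hbq
        have hb1 : b q ∈ closedBall e r := by
          rw [mem_closedBall, dist_eq_norm]; linarith
        have hb2 : b q + θ • e ∈ closedBall e r := by
          rw [mem_closedBall, dist_eq_norm]
          calc ‖b q + θ • e - e‖ = ‖(b q - e) + θ • e‖ := by congr 1; abel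
            _ ≤ ‖b q - e‖ + ‖θ • e‖ := norm_add_le _ _
            _ ≤ r := by linarith
        have hlip := hK.norm_sub_le hb1 hb2
        have hlip' : ‖φ (b q) - φ (b q + θ • e)‖ ≤ ε * Λ * δ := by
          calc _ ≤ K * ‖b q - (b q + θ • e)‖ := hlip
            _ = K * ‖θ • e‖ := by rw [sub_add_cancel_left, norm_neg]
            _ ≤ K * (2 * ε * ‖e‖) := by gcongr
            _ ≤ ε * (2 * K * ‖e‖ + 1) := by nlinarith
            _ = ε * Λ * δ := by rw [hΛ]; field_simp
        have := add_mem_interior C (smul_add_mem_interior C hδe (by positivity) hlip')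
          (hab q (hIco q hq))
        convert this using 1
        abel
      · have h1 := cone_add_mem C ht (C.smul_mem (interior_subset heD) hε0.le)
        show b t + (ε * (1 + Λ * (t - t))) • e - a t ∈ C
        convert h1 using 1
        simp only [sub_self, mul_zero, add_zero, mul_one]
        abel
    refine ⟨w, ?_, htw, hwy⟩
    have hlim : Tendsto (fun ε : ℝ => b w + (ε * (1 + Λ * (w - t))) • e - a w) (𝓝[>] 0)
        (𝓝 (b w + ((0 : ℝ) * (1 + Λ * (w - t))) • e - a w)) :=
      (Continuous.tendsto (by fun_prop) 0).mono_left nhdsWithin_le_nhds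
    rw [zero_mul, zero_smul, add_zero] at hlim
    exact C.isClosed.mem_of_tendsto hlim main

end Comparison

/-! ### Ratios and Thompson's metric in terms of the order. -/

section ThompsonMetric

variable {X : Type*} [NormedAddCommGroup X] [NormedSpace ℝ X]

theorem exists_smul_sub_mem (C : ProperCone ℝ X) {y : X} (hy : y ∈ interior (C : Set X)) (x : X) :
    ∃ L : ℝ, 0 < L ∧ L • y - x ∈ C := by
  obtain ⟨δ, hδ, h⟩ := exists_add_mem_interior C hy
  refine ⟨(‖x‖ + 1) / δ, by positivity, ?_⟩
  rw [sub_eq_add_neg]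
  refine interior_subset (smul_add_mem_interior C h (by positivity) ?_)
  rw [norm_neg, div_mul_cancel₀ _ hδ.ne']
  linarith

theorem Le.smul_le_smul {C : ProperCone ℝ X} {x y : X} {r : ℝ} (h : Le C x y) (hr : 0 ≤ r) :
    Le C (r • x) (r • y) := by
  have := C.smul_mem h hr
  rwa [smul_sub] at this

theorem Le.trans {C : ProperCone ℝ X} {x y z : X} (h : Le C x y) (h' : Le C y z) : Le C x z := by
  have := cone_add_mem C h' h
  rwa [sub_add_sub_cancel] at this

theorem Ll.le {C : ProperCone ℝ X} {x y : X} (h : Ll C x y) : Le C x y := interior_subset h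

theorem le_inv_smul_iff {C : ProperCone ℝ X} {x y : X} {r : ℝ} (hr : 0 < r) :
    Le C (r⁻¹ • y) x ↔ Le C y (r • x) := by
  constructor
  · intro h
    simpa [smul_smul, hr.ne'] using h.smul_le_smul hr.le
  · intro h
    simpa [smul_smul, hr.ne'] using h.smul_le_smul (inv_pos.2 hr).le

theorem smul_le_smul_right {C : ProperCone ℝ X} {x : X} (hx : x ∈ C) {r s : ℝ} (h : r ≤ s) :
    Le C (r • x) (s • x) := by
  have := C.smul_mem hx (sub_nonneg.2 h)
  rwa [sub_smul] at this

theorem mem_interior_of_le {C : ProperCone ℝ X} {x y : X} (hx : x ∈ interior (C : Set X))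
    (h : Le C x y) : y ∈ interior (C : Set X) := by
  have := add_mem_interior C hx h
  rwa [add_sub_cancel] at this

variable [Nontrivial X]

/-- Otherwise `C` would contain every vector together with its negative. -/
theorem IsPointed.zero_notMem_interior {C : ProperCone ℝ X} (hC : IsPointed C) :
    (0 : X) ∉ interior (C : Set X) := by
  intro h0
  obtain ⟨v, hv⟩ := exists_ne (0 : X)
  obtain ⟨L, hL, h⟩ := exists_smul_sub_mem C h0 v
  obtain ⟨L', hL', h'⟩ := exists_smul_sub_mem C h0 (-v)
  exact hv (hC v (by simpa using h') (by simpa using h))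

theorem IsPointed.nonneg_of_smul_mem {C : ProperCone ℝ X} (hC : IsPointed C) {x : X}
    (hx : x ∈ interior (C : Set X)) {r : ℝ} (h : r • x ∈ C) : 0 ≤ r := by
  by_contra! hr
  have h1 := C.smul_mem h (inv_pos.2 (neg_pos.2 hr)).le
  rw [smul_smul, inv_neg, neg_mul, inv_mul_cancel₀ hr.ne, neg_one_smul] at h1
  have := hC x (interior_subset hx) h1
  exact hC.zero_notMem_interior (this ▸ hx)

theorem IsPointed.le_of_smul_le_smul {C : ProperCone ℝ X} (hC : IsPointed C) {x : X}
    (hx : x ∈ interior (C : Set X)) {r s : ℝ} (h : Le C (r • x) (s • x)) : r ≤ s := by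
  unfold Le at h
  rw [← sub_smul] at h
  linarith [hC.nonneg_of_smul_mem hx h]

/-- The infimum is attained because `C` is closed; pointedness bounds the set below and an interior
`y` makes it nonempty. -/
theorem upperRatio_le_iff {C : ProperCone ℝ X} (hC : IsPointed C) {x y : X}
    (hx : x ∈ interior (C : Set X)) (hy : y ∈ interior (C : Set X)) {r : ℝ} :
    upperRatio C x y ≤ r ↔ Le C x (r • y) := by
  have hbdd : BddBelow {t : ℝ | Le C x (t • y)} := by
    refine ⟨0, fun t ht => hC.nonneg_of_smul_mem hy ?_⟩
    have := cone_add_mem C ht (interior_subset hx)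
    rwa [sub_add_cancel] at this
  refine ⟨fun h => ?_, fun h => csInf_le hbdd h⟩
  have hcl : IsClosed {t : ℝ | Le C x (t • y)} :=
    C.isClosed.preimage (f := fun t : ℝ => t • y - x) (by fun_prop)
  obtain ⟨L, -, hL⟩ := exists_smul_sub_mem C hy x
  exact Le.trans (hcl.csInf_mem ⟨L, hL⟩ hbdd) (smul_le_smul_right (interior_subset hy) h)

theorem upperRatio_pos {C : ProperCone ℝ X} (hC : IsPointed C) {x y : X}
    (hx : x ∈ interior (C : Set X)) (hy : y ∈ interior (C : Set X)) : 0 < upperRatio C x y := by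
  by_contra! h
  have h1 := (upperRatio_le_iff hC hx hy).1 h
  have h2 : -x ∈ C := by simpa [Le] using h1
  exact hC.zero_notMem_interior (hC x (interior_subset hx) h2 ▸ hx)

theorem le_lowerRatio_iff {C : ProperCone ℝ X} (hC : IsPointed C) {x y : X}
    (hy : y ∈ interior (C : Set X)) {r : ℝ} :
    r ≤ lowerRatio C x y ↔ Le C (r • y) x := by
  obtain ⟨L, -, hL⟩ := exists_smul_sub_mem C hy x
  obtain ⟨L', -, hL'⟩ := exists_smul_sub_mem C hy (-x)
  have hbdd : BddAbove {t : ℝ | Le C (t • y) x} :=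
    ⟨L, fun t ht => hC.le_of_smul_le_smul hy (Le.trans ht hL)⟩
  refine ⟨fun h => ?_, fun h => le_csSup hbdd h⟩
  have hcl : IsClosed {t : ℝ | Le C (t • y) x} :=
    C.isClosed.preimage (f := fun t : ℝ => x - t • y) (by fun_prop)
  refine Le.trans (smul_le_smul_right (interior_subset hy) h) (hcl.csSup_mem ⟨-L', ?_⟩ hbdd)
  show x - (-L') • y ∈ C
  convert hL' using 1
  rw [neg_smul]; abel

theorem dT_le_iff {C : ProperCone ℝ X} (hC : IsPointed C) {x y : X}
    (hx : x ∈ interior (C : Set X)) (hy : y ∈ interior (C : Set X)) {r : ℝ} :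
    dT C x y ≤ r ↔ Le C x (Real.exp r • y) ∧ Le C (Real.exp (-r) • y) x := by
  rw [dT, Real.log_le_iff_le_exp (lt_max_of_lt_left (upperRatio_pos hC hx hy)), max_le_iff,
    upperRatio_le_iff hC hx hy, upperRatio_le_iff hC hy hx, Real.exp_neg,
    le_inv_smul_iff (Real.exp_pos r)]

theorem dT_nonneg {C : ProperCone ℝ X} (hC : IsPointed C) {x y : X}
    (hx : x ∈ interior (C : Set X)) (hy : y ∈ interior (C : Set X)) : 0 ≤ dT C x y := by
  obtain ⟨h1, h2⟩ := (dT_le_iff hC hx hy).1 le_rfl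
  have := Real.exp_le_exp.1 (hC.le_of_smul_le_smul hy (h2.trans h1))
  linarith

theorem mem_closedInterval_iff_dT_le {C : ProperCone ℝ X} (hC : IsPointed C) {x y : X} {μ : ℝ}
    (hμ : 0 < μ) (hx : x ∈ interior (C : Set X)) (hy : y ∈ interior (C : Set X)) :
    x ∈ closedInterval C (μ⁻¹ • y) (μ • y) ↔ dT C x y ≤ Real.log μ := by
  rw [dT_le_iff hC hx hy, Real.exp_neg, Real.exp_log hμ, and_comm]
  rfl

end ThompsonMetric

theorem closedInterval_subset_interior {X : Type*} [NormedAddCommGroup X] [NormedSpace ℝ X]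
    {C : ProperCone ℝ X} {y : X} {μ : ℝ} (hμ : 0 < μ) (hy : y ∈ interior (C : Set X)) :
    closedInterval C (μ⁻¹ • y) (μ • y) ⊆ interior (C : Set X) :=
  fun _ hx => mem_interior_of_le (smul_mem_interior C (inv_pos.2 hμ) hy) hx.1

theorem hasDerivAt_exp_exp_smul {X : Type*} [NormedAddCommGroup X] [NormedSpace ℝ X]
    (α d s : ℝ) (x : X) :
    HasDerivAt (fun s : ℝ => Real.exp (Real.exp (-α * s) * d) • x)
      (-(α * (Real.exp (Real.exp (-α * s) * d) *
        Real.log (Real.exp (Real.exp (-α * s) * d)))) • x) s := by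
  have h := (((((hasDerivAt_id s).const_mul (-α)).exp).mul_const d).exp).smul_const x
  refine h.congr_deriv ?_
  rw [Real.log_exp]
  congr 1
  simp only [id]
  ring

/-! ### The field on the ray and the contraction rate. -/

section Radial

variable {X : Type*} [NormedAddCommGroup X] [NormedSpace ℝ X]

/-- `φ` on the ray through `e` is bounded by the field whose flow contracts `log` at rate `α`. -/
structure RadialBound (C : ProperCone ℝ X) (φ : X → X) (e : X) (μ α : ℝ) : Prop where
  upper : ∀ l ∈ Icc 1 μ, -(α * (l * Real.log l)) • e - φ (l • e) ∈ C
  lower : ∀ l ∈ Icc μ⁻¹ 1, φ (l • e) - -(α * (l * Real.log l)) • e ∈ C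

theorem le_neg_smul_iff_of_pos {C : ProperCone ℝ X} {e v : X} {α k : ℝ} (hk : 0 < k) :
    Le C (α • e) (-k⁻¹ • v) ↔ -(α * k) • e - v ∈ C := by
  constructor
  · intro h
    have := C.smul_mem h hk.le
    convert this using 1
    match_scalars <;> field_simp
  · intro h
    have := C.smul_mem h (inv_pos.2 hk).le
    show -k⁻¹ • v - α • e ∈ C
    convert this using 1
    match_scalars <;> field_simp

theorem le_neg_smul_iff_of_neg {C : ProperCone ℝ X} {e v : X} {α k : ℝ} (hk : k < 0) :
    Le C (α • e) (-k⁻¹ • v) ↔ v - -(α * k) • e ∈ C := by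
  have := le_neg_smul_iff_of_pos (C := C) (e := e) (v := -v) (α := α) (neg_pos.2 hk)
  have e1 : -(-k)⁻¹ • -v = -k⁻¹ • v := by rw [inv_neg, neg_neg, smul_neg, neg_smul]
  have e2 : -(α * -k) • e - -v = v - -(α * k) • e := by
    rw [mul_neg, neg_neg, neg_smul]; abel
  rwa [e1, e2] at this

theorem mul_log_pos {l : ℝ} (h : 1 < l) : 0 < l * Real.log l :=
  mul_pos (by linarith) (Real.log_pos h)

theorem mul_log_neg {l : ℝ} (h0 : 0 < l) (h : l < 1) : l * Real.log l < 0 :=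
  mul_neg_of_pos_of_neg h0 (Real.log_neg h0 h)

/-- Clearing the factor `l log l` removes the singularity at `l = 1`, so continuity extends the
bound to `1` and to the endpoints `μ⁻¹`, `μ`, all of which the comparison curves may reach. -/
theorem radialBound_of_le [Nontrivial X] {C : ProperCone ℝ X} (hC : IsPointed C) {φ : X → X}
    (hφ : ContinuousOn φ (interior (C : Set X))) {e : X} (he : e ∈ interior (C : Set X))
    {μ α : ℝ} (hμ : 1 < μ)
    (h : ∀ l, μ⁻¹ < l → l < μ → l ≠ 1 →
      α ≤ lowerRatio C (-(l * Real.log l)⁻¹ • φ (l • e)) e) :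
    RadialBound C φ e μ α := by
  have hμ0 : 0 < μ := by linarith
  have hμ1 : μ⁻¹ < 1 := inv_lt_one_of_one_lt₀ hμ
  have hc : ContinuousOn (fun l : ℝ => φ (l • e)) (Ioi 0) :=
    hφ.comp (by fun_prop) (fun l hl => smul_mem_interior C hl he)
  have hc' : ContinuousOn (fun l : ℝ => -(α * (l * Real.log l)) • e) (Ioi 0) := by
    have := Real.continuous_mul_log
    exact Continuous.continuousOn (by fun_prop)
  constructor
  · have hm : MapsTo (fun l : ℝ => -(α * (l * Real.log l)) • e - φ (l • e)) (Ioo 1 μ) C := by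
      intro l hl
      exact (le_neg_smul_iff_of_pos (mul_log_pos hl.1)).1
        ((le_lowerRatio_iff hC he).1 (h l (hμ1.trans hl.1) hl.2 hl.1.ne'))
    have := hm.closure_of_continuousOn ((hc'.sub hc).mono ?_)
    · rwa [closure_Ioo hμ.ne, C.isClosed.closure_eq] at this
    · rw [closure_Ioo hμ.ne]
      exact fun l hl => lt_of_lt_of_le one_pos hl.1
  · have hm : MapsTo (fun l : ℝ => φ (l • e) - -(α * (l * Real.log l)) • e) (Ioo μ⁻¹ 1) C := by
      intro l hl
      exact (le_neg_smul_iff_of_neg (mul_log_neg ((inv_pos.2 hμ0).trans hl.1) hl.2)).1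
        ((le_lowerRatio_iff hC he).1 (h l hl.1 (hl.2.trans hμ) hl.2.ne))
    have := hm.closure_of_continuousOn ((hc.sub hc').mono ?_)
    · rwa [closure_Ioo hμ1.ne, C.isClosed.closure_eq] at this
    · rw [closure_Ioo hμ1.ne]
      exact fun l hl => lt_of_lt_of_le (inv_pos.2 hμ0) hl.1

/-- The expression is monotone in time, whatever the sign of `α`, so its two end values control it.
-/
theorem exp_neg_mul_mul_le {α d m s t : ℝ} (hd : 0 ≤ d) (hdm : d ≤ m)
    (ht : Real.exp (-α * t) * d ≤ m) (h0 : 0 ≤ s) (hst : s ≤ t) :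
    Real.exp (-α * s) * d ≤ m := by
  rcases le_total 0 α with hα | hα
  · refine le_trans ?_ hdm
    have : Real.exp (-α * s) ≤ 1 := Real.exp_le_one_iff.2 (by nlinarith)
    nlinarith
  · refine le_trans ?_ ht
    gcongr
    nlinarith

/-- The distance to the rest point `e` decreases at rate `α` under a radial bound. -/
theorem RadialBound.dT_le [CompleteSpace X] [Nontrivial X] {C : ProperCone ℝ X}
    (hC : IsPointed C) {φ : X → X}
    (hmono : OrderPreservingOn C φ (interior (C : Set X)) (interior (C : Set X)))
    (hL : LocallyLipschitzIn φ (interior (C : Set X))) {e : X} (he : e ∈ interior (C : Set X))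
    {μ α : ℝ} (hμ : 1 < μ) (H : RadialBound C φ e μ α) {x : X} {b t : ℝ} {γ : ℝ → X}
    (hγ : IsSolution φ (interior (C : Set X)) x b γ) (h0 : 0 ≤ t) (htb : t < b)
    (hx : dT C x e ≤ Real.log μ) (ht : Real.exp (-α * t) * dT C x e ≤ Real.log μ) :
    dT C (γ t) e ≤ Real.exp (-α * t) * dT C x e := by
  have hxD : x ∈ interior (C : Set X) := hγ.initial ▸ hγ.mem 0 le_rfl (h0.trans_lt htb)
  set d := dT C x e with hd
  have hd0 : 0 ≤ d := dT_nonneg hC hxD he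
  obtain ⟨hx1, hx2⟩ := (dT_le_iff hC hxD he).1 hd.ge
  have hμ0 : 0 < μ := by linarith
  have hlog : 0 < Real.log μ := Real.log_pos hμ
  have hbound : ∀ s ∈ Ico 0 t, Real.exp (-α * s) * d ≤ Real.log μ :=
    fun s hs => exp_neg_mul_mul_le hd0 hx ht hs.1 hs.2.le
  have hγD : ∀ s ∈ Ico 0 t, γ s ∈ interior (C : Set X) :=
    fun s hs => hγ.mem s hs.1 (hs.2.trans htb)
  have hγd : ∀ s ∈ Ico 0 t, HasDerivWithinAt γ (φ (γ s)) (Ici s) s :=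
    fun s hs => (hγ.deriv s hs.1 (hs.2.trans htb)).mono (Ici_subset_Ici.2 hs.1)
  rw [dT_le_iff hC (hγ.mem t h0 htb) he]
  constructor
  · refine le_of_subsolution hmono hL (hγ.continuousOn le_rfl htb)
      (b := fun s : ℝ => Real.exp (Real.exp (-α * s) * d) • e) (s := 0) (T := t)
      (Continuous.continuousOn (by fun_prop)) hγD
      (fun s _ => smul_mem_interior C (Real.exp_pos _) he) hγd
      (fun s _ => (hasDerivAt_exp_exp_smul α d s e).hasDerivWithinAt) (fun s hs => ?_) ?_
      t ⟨h0, le_rfl⟩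
    · rw [sub_self, sub_zero]
      refine H.upper _ ⟨Real.one_le_exp (by positivity), ?_⟩
      rw [← Real.le_log_iff_exp_le hμ0]
      exact hbound s hs
    · simpa [hγ.initial] using hx1
  -- The lower barrier is the same curve with `-d`, running in `[μ⁻¹, 1]`.
  · have := le_of_subsolution hmono hL (hbc := hγ.continuousOn le_rfl htb)
      (a := fun s : ℝ => Real.exp (Real.exp (-α * s) * -d) • e) (s := 0) (T := t)
      (Continuous.continuousOn (by fun_prop))
      (fun s _ => smul_mem_interior C (Real.exp_pos _) he) hγD
      (fun s _ => (hasDerivAt_exp_exp_smul α (-d) s e).hasDerivWithinAt) hγd (fun s hs => ?_) ?_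
      t ⟨h0, le_rfl⟩
    · simpa only [mul_neg] using this
    · rw [sub_self, zero_sub, neg_sub]
      refine H.lower _ ⟨?_, Real.exp_le_one_iff.2 ?_⟩
      · rw [← Real.exp_log (inv_pos.2 hμ0), Real.log_inv, Real.exp_le_exp]
        have := hbound s hs
        linarith
      · have : 0 ≤ Real.exp (-α * s) * d := by positivity
        linarith
    · simpa [hγ.initial] using hx2

/-- A contraction rate for short times at the points of the ray through `e` bounds `φ` there. -/
theorem le_lowerRatio_of_dT_le [Nontrivial X] {C : ProperCone ℝ X} (hC : IsPointed C) {φ : X → X}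
    {e : X} (he : e ∈ interior (C : Set X)) {β l b : ℝ} (hl : 0 < l) (hl1 : l ≠ 1) {γ : ℝ → X}
    (hb : 0 < b) (hγ : IsSolution φ (interior (C : Set X)) (l • e) b γ)
    (h : ∀ t, 0 ≤ t → t < b → dT C (γ t) e ≤ Real.exp (-β * t) * dT C (l • e) e) :
    β ≤ lowerRatio C (-(l * Real.log l)⁻¹ • φ (l • e)) e := by
  rw [le_lowerRatio_iff hC he]
  have hle := smul_mem_interior C hl he
  have hev : ∀ᶠ t in 𝓝[>] (0 : ℝ), 0 < t ∧ t < b :=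
    (eventually_mem_nhdsWithin (s := Ioi (0 : ℝ))).and
      (mem_nhdsWithin_of_mem_nhds (Iio_mem_nhds hb))
  have hd := (hasDerivAt_exp_exp_smul β (Real.log l) 0 e).hasDerivWithinAt (s := Ici 0)
  have hd' := hγ.deriv 0 le_rfl hb
  simp only [mul_zero, Real.exp_zero, one_mul, Real.exp_log hl] at hd
  rw [hγ.initial] at hd'
  rcases hl1.lt_or_gt with hl1 | hl1
  · rw [le_neg_smul_iff_of_neg (mul_log_neg hl hl1)]
    -- The trajectory and the barrier coincide at time `0`, so their order at small times passes to
    -- their velocities.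
    refine mem_of_hasDerivWithinAt C (hd'.sub hd) ?_
    have h0 : dT C (l • e) e ≤ -Real.log l := by
      rw [dT_le_iff hC hle he, neg_neg, Real.exp_neg, Real.exp_log hl]
      refine ⟨smul_le_smul_right (interior_subset he) ?_,
        smul_le_smul_right (interior_subset he) le_rfl⟩
      exact hl1.le.trans ((one_le_inv₀ hl).2 hl1.le)
    filter_upwards [hev] with t ht
    have h1 : dT C (γ t) e ≤ Real.exp (-β * t) * -Real.log l :=
      (h t ht.1.le ht.2).trans (by gcongr)
    have h2 := ((dT_le_iff hC (hγ.mem t ht.1.le ht.2) he).1 h1).2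
    rw [mul_neg, neg_neg] at h2
    simpa [hγ.initial, Real.exp_log hl, Le] using h2
  · rw [le_neg_smul_iff_of_pos (mul_log_pos hl1)]
    refine mem_of_hasDerivWithinAt C (hd.sub hd') ?_
    have h0 : dT C (l • e) e ≤ Real.log l := by
      rw [dT_le_iff hC hle he, Real.exp_neg, Real.exp_log hl]
      refine ⟨smul_le_smul_right (interior_subset he) le_rfl,
        smul_le_smul_right (interior_subset he) ?_⟩
      exact (inv_le_one_of_one_le₀ hl1.le).trans hl1.le
    filter_upwards [hev] with t ht
    have h1 : dT C (γ t) e ≤ Real.exp (-β * t) * Real.log l :=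
      (h t ht.1.le ht.2).trans (by gcongr)
    have h2 := ((dT_le_iff hC (hγ.mem t ht.1.le ht.2) he).1 h1).1
    simpa [hγ.initial, Real.exp_log hl, Le] using h2

end Radial

/-! ### Finiteness of the rate and global existence. -/

section Global

variable {X : Type*} [NormedAddCommGroup X] [NormedSpace ℝ X]

theorem IsAdmissible.continuousOn {φ : X → X} {D : Set X} (hφ : IsAdmissible φ D) :
    ContinuousOn φ D :=
  fun x hx => (hφ.1 x hx).continuousAt.continuousWithinAt

theorem isOpen_openInterval (C : ProperCone ℝ X) (x y : X) : IsOpen (openInterval C x y) :=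
  (isOpen_interior.preimage (f := fun z => z - x) (by fun_prop)).inter
    (isOpen_interior.preimage (f := fun z => y - z) (by fun_prop))

theorem openInterval_subset_closedInterval (C : ProperCone ℝ X) (x y : X) :
    openInterval C x y ⊆ closedInterval C x y :=
  fun _ hz => ⟨hz.1.le, hz.2.le⟩

theorem smul_mem_openInterval {C : ProperCone ℝ X} {e : X} (he : e ∈ interior (C : Set X))
    {a b l : ℝ} (ha : a < l) (hb : l < b) : l • e ∈ openInterval C (a • e) (b • e) := by
  constructor
  · show l • e - a • e ∈ interior (C : Set X)
    rw [← sub_smul]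
    exact smul_mem_interior C (sub_pos.2 ha) he
  · show b • e - l • e ∈ interior (C : Set X)
    rw [← sub_smul]
    exact smul_mem_interior C (sub_pos.2 hb) he

/-- Uses `1 - l⁻¹ ≤ log l` above `1` and `log l ≤ l - 1` below it, where `μ` compensates the factor
`l > μ⁻¹`. -/
theorem abs_sub_one_le_mul_abs_mul_log {μ l : ℝ} (hμ : 1 < μ) (hl : μ⁻¹ < l) :
    |l - 1| ≤ μ * |l * Real.log l| := by
  have hμ0 : 0 < μ := by linarith
  have hl0 : 0 < l := (inv_pos.2 hμ0).trans hl
  have hμl : 1 < μ * l := by rwa [inv_lt_iff_one_lt_mul₀ hμ0, mul_comm] at hl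
  rcases le_total 1 l with h | h
  · have h1 := Real.one_sub_inv_le_log_of_pos hl0
    have h2 : l - 1 ≤ l * Real.log l := by
      calc l - 1 = l * (1 - l⁻¹) := by field_simp
        _ ≤ _ := by gcongr
    rw [abs_of_nonneg (sub_nonneg.2 h), abs_of_nonneg (by linarith)]
    nlinarith
  · have h1 := Real.log_le_sub_one_of_pos hl0
    have h2 : Real.log l ≤ 0 := by linarith
    rw [abs_of_nonpos (sub_nonpos.2 h), abs_of_nonpos (by nlinarith)]
    nlinarith

/-- The lower ratios of the normalized field on the ray through a rest point are bounded below. -/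
theorem bddBelow_lowerRatio [Nontrivial X] {C : ProperCone ℝ X} (hC : IsPointed C) {φ : X → X}
    (hφ : IsAdmissible φ (interior (C : Set X))) {e : X} (he : e ∈ interior (C : Set X))
    (hzero : φ e = 0) {μ : ℝ} (hμ : 1 < μ) :
    BddBelow {r : ℝ | ∃ l : ℝ, μ⁻¹ < l ∧ l < μ ∧ l ≠ 1 ∧
      r = lowerRatio C (-(l * Real.log l)⁻¹ • φ (l • e)) e} := by
  have hμ0 : 0 < μ := by linarith
  have hμ1 : μ⁻¹ < 1 := inv_lt_one_of_one_lt₀ hμ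
  obtain ⟨δ, hδ, hδe⟩ := exists_add_mem_interior C he
  set S : Set X := (fun l : ℝ => l • e) '' Icc μ⁻¹ μ with hS
  have hSc : IsCompact S := isCompact_Icc.image (by fun_prop)
  have hSv : Convex ℝ S := (convex_Icc _ _).is_linear_image (IsLinearMap.isLinearMap_smul' e)
  have hSD : S ⊆ interior (C : Set X) := by
    rintro _ ⟨l, hl, rfl⟩
    exact smul_mem_interior C ((inv_pos.2 hμ0).trans_le hl.1) he
  obtain ⟨K, hK⟩ := hφ.exists_lipschitzOnWith hSD hSc.isClosed hSc.isBounded hSv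
  -- Since `φ e = 0`, the normalized field has norm at most `K μ ‖e‖` on the ray; the `+ 1` keeps
  -- `L` positive.
  set L : ℝ := (K * μ * ‖e‖ + 1) / δ with hLdef
  have hLp : 0 < L := by positivity
  refine ⟨-L, ?_⟩
  rintro _ ⟨l, hl1, hl2, hl, rfl⟩
  rw [le_lowerRatio_iff hC he]
  have h1 : (1 : ℝ) • e ∈ S := ⟨1, ⟨hμ1.le, hμ.le⟩, rfl⟩
  have h2 : l • e ∈ S := ⟨l, ⟨hl1.le, hl2.le⟩, rfl⟩
  have h3 := hK.norm_sub_le h2 h1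
  rw [one_smul, hzero, sub_zero] at h3
  have h4 : ‖l • e - e‖ = |l - 1| * ‖e‖ := by
    rw [← Real.norm_eq_abs, ← norm_smul, sub_smul, one_smul]
  have h5 := abs_sub_one_le_mul_abs_mul_log hμ hl1
  have hk : 0 < |l * Real.log l| := by
    have hl0 : 0 < l := (inv_pos.2 hμ0).trans hl1
    exact abs_pos.2 (mul_ne_zero hl0.ne' (Real.log_ne_zero_of_pos_of_ne_one hl0 hl))
  have h6 : ‖-(l * Real.log l)⁻¹ • φ (l • e)‖ ≤ L * δ := by
    rw [norm_smul, norm_neg, norm_inv, Real.norm_eq_abs, inv_mul_le_iff₀ hk]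
    calc ‖φ (l • e)‖ ≤ K * (|l - 1| * ‖e‖) := by rw [← h4]; exact h3
      _ ≤ K * (μ * |l * Real.log l| * ‖e‖) := by gcongr
      _ = |l * Real.log l| * (K * μ * ‖e‖) := by ring
      _ ≤ |l * Real.log l| * (K * μ * ‖e‖ + 1) := by gcongr; linarith
      _ = |l * Real.log l| * (L * δ) := by rw [hLdef, div_mul_cancel₀ _ hδ.ne']
  have h7 := interior_subset (smul_add_mem_interior C hδe hLp h6)
  rwa [Le, neg_smul L, sub_neg_eq_add, add_comm]

/-- Solutions issued from an order interval of a normal cone exist on a common time interval. -/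
theorem IsNormal.exists_uniform_time [CompleteSpace X] {C : ProperCone ℝ X} (hN : IsNormal C)
    {φ : X → X} (hφ : IsAdmissible φ (interior (C : Set X))) {p q : X}
    (hp : p ∈ interior (C : Set X)) :
    ∃ τ : ℝ, 0 < τ ∧ ∀ z ∈ closedInterval C p q,
      ∃ γ : ℝ → X, IsSolution φ (interior (C : Set X)) z τ γ := by
  obtain ⟨N, hN⟩ := hN
  -- Lowering `p` to `p / 2` leaves room for a ball of fixed radius `δ` around each point of the
  -- interval, inside a closed bounded convex set `S` that stays in the interior of the cone.
  have hp2 : (2 : ℝ)⁻¹ • p ∈ interior (C : Set X) := smul_mem_interior C (by norm_num) hp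
  obtain ⟨δ, hδ, hδp⟩ := exists_add_mem_interior C hp2
  set R : ℝ := max (N * ‖q‖) ‖p‖ + δ with hR
  set S : Set X := {z | z - (2 : ℝ)⁻¹ • p ∈ C} ∩ closedBall 0 R with hS
  have hSD : S ⊆ interior (C : Set X) := fun z hz => mem_interior_of_le hp2 hz.1
  have hSc : IsClosed S :=
    (C.isClosed.preimage (f := fun z => z - (2 : ℝ)⁻¹ • p) (by fun_prop)).inter isClosed_closedBall
  have hSb : Bornology.IsBounded S := isBounded_closedBall.subset inter_subset_right
  have hSv : Convex ℝ S := by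
    refine Convex.inter ?_ (convex_closedBall _ _)
    intro x hx y hy a b ha hb hab
    have := cone_add_mem C (C.smul_mem hx ha) (C.smul_mem hy hb)
    show a • x + b • y - (2 : ℝ)⁻¹ • p ∈ C
    convert this using 1
    obtain rfl : b = 1 - a := by linarith
    module
  have hball : ∀ z ∈ closedInterval C p q, closedBall z δ ⊆ S := by
    intro z hz y hy
    rw [mem_closedBall, dist_eq_norm] at hy
    have hz0 : Le C 0 z := by
      have := cone_add_mem C (interior_subset hp) hz.1
      rw [add_sub_cancel] at this
      rwa [Le, sub_zero]
    constructor
    · have h1 := cone_add_mem C (interior_subset (hδp _ hy)) hz.1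
      show y - (2 : ℝ)⁻¹ • p ∈ C
      convert h1 using 1
      module
    · rw [mem_closedBall_zero_iff]
      have h1 : ‖y‖ ≤ ‖y - z‖ + ‖z‖ := norm_le_norm_sub_add _ _
      have h2 := hN z q hz0 hz.2
      have h3 := le_max_left (N * ‖q‖) ‖p‖
      linarith
  have hpS : p ∈ S := by
    constructor
    · have := C.smul_mem (interior_subset hp) (r := (2 : ℝ)⁻¹) (by norm_num)
      show p - (2 : ℝ)⁻¹ • p ∈ C
      convert this using 1
      module
    · rw [mem_closedBall_zero_iff]
      have h3 := le_max_right (N * ‖q‖) ‖p‖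
      linarith
  obtain ⟨K, hK⟩ := hφ.exists_lipschitzOnWith hSD hSc hSb hSv
  set B : ℝ := K * (R + R) + ‖φ p‖ with hB
  have hB' : ∀ y ∈ S, ‖φ y‖ ≤ B := by
    intro y hy
    have h1 : ‖y - p‖ ≤ R + R := (norm_sub_le _ _).trans
      (add_le_add (mem_closedBall_zero_iff.1 hy.2) (mem_closedBall_zero_iff.1 hpS.2))
    calc ‖φ y‖ ≤ ‖φ y - φ p‖ + ‖φ p‖ := norm_le_norm_sub_add _ _
      _ ≤ K * ‖y - p‖ + ‖φ p‖ := by gcongr; exact hK.norm_sub_le hy hpS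
      _ ≤ B := by rw [hB]; gcongr
  have hB0 : 0 ≤ B := (norm_nonneg _).trans (hB' p hpS)
  refine ⟨δ / (B + 1), by positivity, fun z hz => ?_⟩
  refine exists_isSolution_of_lipschitzOnWith (B := B) ((hball z hz).trans hSD)
    (hK.mono (hball z hz)) (fun y hy => hB' y (hball z hz hy)) hδ.le (by positivity) ?_
  rw [← mul_div_assoc, div_le_iff₀ (by positivity)]
  nlinarith

/-- A solution that stays in a set with a uniform existence time is global. -/
theorem existenceTime_eq_top_of_uniform_time {φ : X → X} {D S : Set X} {τ : ℝ} (hτ : 0 < τ)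
    (h : ∀ z ∈ S, ∃ γ : ℝ → X, IsSolution φ D z τ γ) {x : X} (hx : x ∈ S)
    (hS : ∀ (b : ℝ) (γ : ℝ → X), IsSolution φ D x b γ → ∀ t, 0 ≤ t → t < b → γ t ∈ S) :
    existenceTime φ D x = ⊤ := by
  -- Solutions live on half-open intervals, so the restart takes place `τ / 2` before the end and
  -- each step gains `τ / 2`.
  have key : ∀ n : ℕ, ∃ γ : ℝ → X, IsSolution φ D x (τ + n * (τ / 2)) γ := by
    intro n
    induction n with
    | zero => simpa using h x hx
    | succ n ih =>
      obtain ⟨γ, hγ⟩ := ih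
      have h0 : 0 ≤ (n : ℝ) * (τ / 2) := by positivity
      have hc0 : 0 ≤ τ / 2 + n * (τ / 2) := by positivity
      have hcb : τ / 2 + n * (τ / 2) < τ + n * (τ / 2) := by linarith
      obtain ⟨η, hη⟩ := h _ (hS _ γ hγ _ hc0 hcb)
      obtain ⟨ζ, hζ⟩ := hγ.glue hc0 hcb hη
      refine ⟨ζ, ?_⟩
      convert hζ using 1
      push_cast
      ring
  rw [EReal.eq_top_iff_forall_lt]
  intro y
  obtain ⟨n, hn⟩ := exists_nat_gt (|y| / (τ / 2))
  rw [div_lt_iff₀ (half_pos hτ)] at hn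
  obtain ⟨γ, hγ⟩ := key n
  refine (EReal.coe_le_coe_iff.2 (le_abs_self y)).trans_lt
    (hγ.lt_existenceTime (abs_nonneg y) (by linarith))

end Global

end Thompson

/-! ### The convergence rate theorem. -/

theorem mainTheorem5 {X : Type*} [NormedAddCommGroup X] [NormedSpace ℝ X] [CompleteSpace X]
    [Nontrivial X] (C : ProperCone ℝ X) (hC : Thompson.IsPointed C)
    (φ : X → X) (hφ : Thompson.IsAdmissible φ (interior (C : Set X)))
    (hmono : Thompson.OrderPreservingOn C φ (interior (C : Set X)) (interior (C : Set X)))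
    (xbar : X) (hxbar : xbar ∈ interior (C : Set X)) (hzero : φ xbar = 0)
    (μ : ℝ) (hμ : 1 < μ) :
    ∃ α : ℝ,
      IsGLB {r : ℝ | ∃ l : ℝ, μ⁻¹ < l ∧ l < μ ∧ l ≠ 1 ∧
        r = Thompson.lowerRatio C (-(l * Real.log l)⁻¹ • φ (l • xbar)) xbar} α ∧
      IsGreatest {β : ℝ | ∀ x ∈ Thompson.openInterval C (μ⁻¹ • xbar) (μ • xbar),
        ∀ t : ℝ, 0 ≤ t →
          (t : EReal) < Thompson.exitTime φ (interior (C : Set X))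
            (Thompson.openInterval C (μ⁻¹ • xbar) (μ • xbar)) x →
          Thompson.dT C (Thompson.flow φ (interior (C : Set X)) t x) xbar ≤
            Real.exp (-β * t) * Thompson.dT C x xbar} α ∧
      (0 ≤ α → ∀ x ∈ Thompson.closedInterval C (μ⁻¹ • xbar) (μ • xbar),
        (∀ t : ℝ, 0 ≤ t → (t : EReal) < Thompson.existenceTime φ (interior (C : Set X)) x →
          Thompson.dT C (Thompson.flow φ (interior (C : Set X)) t x) xbar ≤
            Real.exp (-α * t) * Thompson.dT C x xbar) ∧
        (Thompson.IsNormal C →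
          Thompson.existenceTime φ (interior (C : Set X)) x = ⊤)) := by
  open Thompson Set Filter Topology in
  have hμ0 : 0 < μ := by linarith
  have hμ1 : μ⁻¹ < 1 := inv_lt_one_of_one_lt₀ hμ
  have hL := hφ.locallyLipschitzIn isOpen_interior
  have hsub := closedInterval_subset_interior hμ0 hxbar
  have hne : {r : ℝ | ∃ l : ℝ, μ⁻¹ < l ∧ l < μ ∧ l ≠ 1 ∧
      r = lowerRatio C (-(l * Real.log l)⁻¹ • φ (l • xbar)) xbar}.Nonempty := by
    obtain ⟨l, hl1, hl2⟩ := exists_between hμ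
    exact ⟨_, l, hμ1.trans hl1, hl2, hl1.ne', rfl⟩
  obtain ⟨α, hα⟩ := Real.exists_isGLB hne (bddBelow_lowerRatio hC hφ hxbar hzero hμ)
  have hH : RadialBound C φ xbar μ α := radialBound_of_le hC hφ.continuousOn hxbar hμ
    fun l h1 h2 h3 => hα.1 ⟨l, h1, h2, h3, rfl⟩
  have hlog : ∀ {x : X}, x ∈ closedInterval C (μ⁻¹ • xbar) (μ • xbar) →
      dT C x xbar ≤ Real.log μ := fun hx =>
    (mem_closedInterval_iff_dT_le hC hμ0 (hsub hx) hxbar).1 hx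
  refine ⟨α, hα, ⟨?_, ?_⟩, ?_⟩
  · intro x hx t h0 ht
    obtain ⟨b, htb, γ, hγ, hγU⟩ := exists_isSolution_of_lt_exitTime hL ht
    rw [hγ.flow_eq hL h0 htb]
    -- For `α < 0` the barriers may leave the range where the radial bound holds; the estimate is
    -- then weaker than membership in `U`.
    rcases le_total (Real.exp (-α * t) * dT C x xbar) (Real.log μ) with h | h
    · exact hH.dT_le hC hmono hL hxbar hμ hγ h0 htb
        (hlog (openInterval_subset_closedInterval C _ _ hx)) h
    · exact (hlog (openInterval_subset_closedInterval C _ _ (hγU t h0 htb))).trans h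
  · intro β hβ
    refine hα.2 ?_
    rintro _ ⟨l, hl1, hl2, hl, rfl⟩
    have hl0 : 0 < l := (inv_pos.2 hμ0).trans hl1
    have hlU := smul_mem_openInterval hxbar hl1 hl2
    obtain ⟨b, hb, γ, hγ⟩ := hL.exists_isSolution (smul_mem_interior C hl0 hxbar)
    have hev : ∀ᶠ t in 𝓝[≥] (0 : ℝ), γ t ∈ openInterval C (μ⁻¹ • xbar) (μ • xbar) :=
      (hγ.continuousWithinAt le_rfl hb).eventually
        ((isOpen_openInterval C _ _).mem_nhds (by rwa [hγ.initial]))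
    -- The rate `β` is only assumed before the exit from `U`, so the trajectory is cut to a short
    -- time on which it stays in `U`.
    obtain ⟨u, hu : 0 < u, hsubU⟩ := mem_nhdsGE_iff_exists_Icc_subset.1 hev
    have hγ' := hγ.mono (min_le_left b u)
    refine le_lowerRatio_of_dT_le hC hxbar hl0 hl (lt_min hb hu) hγ' fun t h0 ht => ?_
    rw [← hγ'.flow_eq hL h0 ht]
    exact hβ _ hlU t h0 (lt_exitTime hL hγ' h0 ht fun s hs0 hs =>
      hsubU ⟨hs0, hs.le.trans (min_le_right _ _)⟩)
  · intro hα0 x hx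
    have hle : ∀ t : ℝ, 0 ≤ t → Real.exp (-α * t) * dT C x xbar ≤ Real.log μ := by
      intro t h0
      have h1 : Real.exp (-α * t) ≤ 1 := Real.exp_le_one_iff.2 (by nlinarith)
      exact (mul_le_of_le_one_left (dT_nonneg hC (hsub hx) hxbar) h1).trans (hlog hx)
    have hest : ∀ (b : ℝ) (γ : ℝ → X), IsSolution φ (interior (C : Set X)) x b γ →
        ∀ t, 0 ≤ t → t < b → dT C (γ t) xbar ≤ Real.exp (-α * t) * dT C x xbar :=
      fun b γ hγ t h0 htb =>
        hH.dT_le hC hmono hL hxbar hμ hγ h0 htb (hlog hx) (hle t h0)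
    refine ⟨fun t h0 ht => ?_, fun hN => ?_⟩
    · obtain ⟨b, htb, γ, hγ⟩ := exists_isSolution_of_lt_existenceTime ht
      rw [hγ.flow_eq hL h0 htb]
      exact hest b γ hγ t h0 htb
    · obtain ⟨τ, hτ, h⟩ := hN.exists_uniform_time hφ (q := μ • xbar)
        (smul_mem_interior C (inv_pos.2 hμ0) hxbar)
      refine existenceTime_eq_top_of_uniform_time hτ h hx fun b γ hγ t h0 htb => ?_
      exact (mem_closedInterval_iff_dT_le hC hμ0 (hγ.mem t h0 htb) hxbar).2
        ((hest b γ hγ t h0 htb).trans (hle t h0))
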